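/- For $g \in \mathbb{C}^{\mathbb{Z}}$, $t \in \mathbb{Z}$ and $m,n \in \mathbb{Z}_{\ge 0}$ let $T^g(t,m,n) := (g_{t+i-j})_{1 \le i \le m,\ 1 \le j \le n} \in \mathbb{C}^{m \times n}$ be the Toeplitz matrix whose $(1,1)$ entry is $g_t$, and let the Toeplitz operator $\mathcal{T}^g$ be the operator given by the infinite matrix $(g_{i-j})_{i,j \ge 0}$. For $1 \le k \le \min\{m,n\}$, a matrix $X \in \mathbb{C}^{m \times n}$ is called $k$-sign consistent if all its $k \times k$ minors are real and nonnegative or all of them are real and nonpositive, and strictly $k$-sign consistent if all its $k \times k$ minors are real and positive or all of them are real and negative. The operator $\mathcal{T}^g$ is called (strictly) $k$-sign consistent if $T^g(0,N,N)$ is (strictly) $k$-sign consistent for all $N \ge k$. Let $g \in \mathbb{C}^{\mathbb{Z}}$ and let $k \ge 1$ be an integer. 1. For all $t \in \mathbb{Z}$ and all positive integers $M,N$ with $k \le \min\{M,N\}$: if the reshaped Toeplitz matrix $T^g(t+M-k,\,k,\,M+N-k)$ is (strictly) $k$-sign consistent, then $T^g(t,M,N)$ is (strictly) $k$-sign consistent.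 2. The Toeplitz operator $\mathcal{T}^g$ is (strictly) $k$-sign consistent if and only if $T^g(N-k,\,k,\,2N-k)$ is (strictly) $k$-sign consistent for all $N \ge k$. Both statements hold in the non-strict version and in the strict version. -/

import Mathlib

/-- The `k`-minor of `X` with the increasing row indices `p` and the increasing column
indices `q`. -/
noncomputable def kMinor {m n k : ℕ} (X : Matrix (Fin m) (Fin n) ℂ)
    (p : Fin k ↪o Fin m) (q : Fin k ↪o Fin n) : ℂ :=
  (X.submatrix p q).det

open scoped ComplexOrder in
/-- `X` is `k`-sign consistent: all its `k`-minors are (real and) nonnegative, or all are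
(real and) nonpositive. In the order on `ℂ` used here, `0 ≤ z` says that `z` is a nonnegative
real number and `z ≤ 0` that it is a nonpositive real number. -/
def IsSignConsistent {m n : ℕ} (k : ℕ) (X : Matrix (Fin m) (Fin n) ℂ) : Prop :=
  (∀ (p : Fin k ↪o Fin m) (q : Fin k ↪o Fin n), 0 ≤ kMinor X p q) ∨
    (∀ (p : Fin k ↪o Fin m) (q : Fin k ↪o Fin n), kMinor X p q ≤ 0)

open scoped ComplexOrder in
/-- `X` is strictly `k`-sign consistent: all its `k`-minors are (real and) positive, or all are
(real and) negative. -/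
def IsStrictlySignConsistent {m n : ℕ} (k : ℕ) (X : Matrix (Fin m) (Fin n) ℂ) : Prop :=
  (∀ (p : Fin k ↪o Fin m) (q : Fin k ↪o Fin n), 0 < kMinor X p q) ∨
    (∀ (p : Fin k ↪o Fin m) (q : Fin k ↪o Fin n), kMinor X p q < 0)

/-- The Toeplitz matrix `T^g(t, m, n)`, with entry `g (t + i - j)` in row `i` and column `j`
(rows and columns counted from `0`). -/
def toeplitzMatrix (g : ℤ → ℂ) (t : ℤ) (m n : ℕ) : Matrix (Fin m) (Fin n) ℂ :=
  Matrix.of fun i j => g (t + ((i : ℕ) : ℤ) - ((j : ℕ) : ℤ))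

/-- The Toeplitz operator `𝒯^g`, given by its infinite matrix, with entry `g (i - j)` in row
`i` and column `j` for `i, j = 0, 1, 2, …`. -/
def toeplitzOperator (g : ℤ → ℂ) : Matrix ℕ ℕ ℂ :=
  Matrix.of fun i j => g ((i : ℤ) - (j : ℤ))

/-- The leading `N × N` section of an infinite matrix. -/
def leadingSection (A : Matrix ℕ ℕ ℂ) (N : ℕ) : Matrix (Fin N) (Fin N) ℂ :=
  A.submatrix (fun i => (i : ℕ)) (fun j => (j : ℕ))

/-- The leading sections of the Toeplitz operator are the matrices `T^g(0, N, N)`. -/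
theorem leadingSection_toeplitzOperator (g : ℤ → ℂ) (N : ℕ) :
    leadingSection (toeplitzOperator g) N = toeplitzMatrix g 0 N N := by
  ext i j
  simp [leadingSection, toeplitzOperator, toeplitzMatrix]

/-- An operator given by an infinite matrix is `k`-sign consistent if its leading `N × N`
section is `k`-sign consistent for all `N ≥ k`. -/
def IsSignConsistentOperator (k : ℕ) (A : Matrix ℕ ℕ ℂ) : Prop :=
  ∀ N : ℕ, k ≤ N → IsSignConsistent k (leadingSection A N)

/-- An operator given by an infinite matrix is strictly `k`-sign consistent if its leading
`N × N` section is strictly `k`-sign consistent for all `N ≥ k`. -/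
def IsStrictlySignConsistentOperator (k : ℕ) (A : Matrix ℕ ℕ ℂ) : Prop :=
  ∀ N : ℕ, k ≤ N → IsStrictlySignConsistent k (leadingSection A N)

/-! With `h z = g (t - z)`, a `k`-minor of a Toeplitz matrix is `det (h (v i + u j))`, where `v` is
the negated row indices and `u` the column indices. Up to a shift, `v` is the staircase `δ = (0, -1,
…)` plus a partition `γ` inside a `k × (M - k)` box. A symmetric polynomial, acting by shifts of the
exponents, acts equally on `v` and on `u`. The Schur polynomial of `γ` sends `δ` to `δ + γ`; on `u`
it yields, by the Littlewood–Richardson rule, a sum of determinants with rows `δ` and columns `u +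
weight`. Rows `δ` are consecutive, so these are maximal minors of the reshaped matrix. All
coefficients are `1` and the sum is nonempty, so signs carry over, strictly too.

The rule (`hankelDet_staircase_add`) follows Stembridge's argument. Bender–Knuth toggles of whole
rows give symmetry (`sum_patternWeight_comp_perm`); toggles cut off at the first violation cancel
every pattern that is not Littlewood–Richardson (`sum_alternating_add_patternWeight`). -/

open Finset

/-! ### Gelfand–Tsetlin patterns and Bender–Knuth toggles. -/

/-- Gelfand–Tsetlin patterns with top row `β`: row `i` is supported on the first `i` positions,
consecutive rows interlace, and all rows from the `k`-th on are equal to `β`. -/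
structure IsGelfandTsetlin (k : ℕ) (β : ℕ → ℕ) (x : ℕ → ℕ → ℕ) : Prop where
  eq_zero : ∀ i j, i ≤ j → x i j = 0
  le_succ : ∀ i j, x i j ≤ x (i + 1) j
  succ_le : ∀ i j, x (i + 1) (j + 1) ≤ x i j
  top : ∀ i, k ≤ i → x i = β

/-- The number of boxes of the row lengths `r` that lie strictly to the right of column `c`. -/
def boxesBeyond (k c : ℕ) (r : ℕ → ℕ) : ℕ := ∑ j ∈ range k, (r j - c)

/-- The weight of a pattern: the differences of consecutive row sums. -/
def patternWeight (k : ℕ) (x : ℕ → ℕ → ℕ) (i : Fin k) : ℤ :=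
  (boxesBeyond k 0 (x (i + 1)) : ℤ) - boxesBeyond k 0 (x i)

/-- The least admissible value at position `j` of a row between `b` (below) and `a` (above). -/
def interlaceLower (a b : ℕ → ℕ) (j : ℕ) : ℕ := max (a (j + 1)) (b j)

/-- The largest admissible value at position `j` of a row between `b` and `a`. -/
def interlaceUpper (a b : ℕ → ℕ) : ℕ → ℕ
  | 0 => a 0
  | j + 1 => min (a (j + 1)) (b j)

/-- The row `z` between `b` and `a` with its entries up to level `c` reflected in the interval of
admissible values. -/
def toggleRow (c : ℕ) (a z b : ℕ → ℕ) (j : ℕ) : ℕ :=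
  if c < z j then z j else interlaceLower a b j + min (interlaceUpper a b j) c - z j

/-- The Bender–Knuth involution at row `i + 1`, restricted to the columns up to `c`. -/
def togglePattern (c i : ℕ) (x : ℕ → ℕ → ℕ) : ℕ → ℕ → ℕ :=
  Function.update x (i + 1) (toggleRow c (x (i + 2)) (x (i + 1)) (x i))

theorem boxesBeyond_eq_succ_add (k c : ℕ) (r : ℕ → ℕ) :
    boxesBeyond k c r = boxesBeyond k (c + 1) r + ∑ j ∈ range k, if c < r j then 1 else 0 := by
  unfold boxesBeyond
  rw [← sum_add_distrib]
  refine sum_congr rfl fun j _ => ?_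
  split_ifs <;> omega

theorem boxesBeyond_zero_eq (k c : ℕ) (r : ℕ → ℕ) :
    boxesBeyond k 0 r = boxesBeyond k c r + ∑ j ∈ range k, min (r j) c := by
  unfold boxesBeyond
  rw [← sum_add_distrib]
  refine sum_congr rfl fun j _ => ?_
  omega

namespace IsGelfandTsetlin

variable {k : ℕ} {β : ℕ → ℕ} {x : ℕ → ℕ → ℕ}

theorem le_top (hx : IsGelfandTsetlin k β x) (i j : ℕ) : x i j ≤ β j := by
  have h : Monotone fun i => x i j := monotone_nat_of_le_succ fun i => hx.le_succ i j
  rw [← hx.top (max i k) (le_max_right _ _)]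
  exact h (le_max_left i k)

theorem lower_le (hx : IsGelfandTsetlin k β x) (i j : ℕ) :
    interlaceLower (x (i + 2)) (x i) j ≤ x (i + 1) j :=
  max_le (hx.succ_le (i + 1) j) (hx.le_succ i j)

theorem le_upper (hx : IsGelfandTsetlin k β x) (i j : ℕ) :
    x (i + 1) j ≤ interlaceUpper (x (i + 2)) (x i) j := by
  cases j with
  | zero => exact hx.le_succ (i + 1) 0
  | succ j => exact le_min (hx.le_succ (i + 1) _) (hx.succ_le i j)

theorem lower_le_toggleRow (hx : IsGelfandTsetlin k β x) (c i j : ℕ) :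
    interlaceLower (x (i + 2)) (x i) j ≤ toggleRow c (x (i + 2)) (x (i + 1)) (x i) j := by
  have h1 := hx.lower_le i j
  have h2 := hx.le_upper i j
  unfold toggleRow
  split_ifs <;> omega

theorem toggleRow_le_upper (hx : IsGelfandTsetlin k β x) (c i j : ℕ) :
    toggleRow c (x (i + 2)) (x (i + 1)) (x i) j ≤ interlaceUpper (x (i + 2)) (x i) j := by
  have h1 := hx.lower_le i j
  have h2 := hx.le_upper i j
  unfold toggleRow
  split_ifs <;> omega

theorem togglePattern (hx : IsGelfandTsetlin k β x) (c : ℕ) {i : ℕ} (hi : i + 1 < k) :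
    IsGelfandTsetlin k β (togglePattern c i x) := by
  have hL := hx.lower_le_toggleRow c i
  have hU := hx.toggleRow_le_upper c i
  unfold _root_.togglePattern
  refine ⟨fun l j hlj => ?_, fun l j => ?_, fun l j => ?_, fun l hl => ?_⟩
  · rcases eq_or_ne l (i + 1) with rfl | h
    · rw [Function.update_self]
      obtain ⟨j, rfl⟩ : ∃ j', j = j' + 1 := ⟨j - 1, by omega⟩
      have h3 := hU (j + 1)
      have h4 := hx.eq_zero i j (by omega)
      simp only [interlaceUpper] at h3
      omega
    · rw [Function.update_of_ne h]
      exact hx.eq_zero l j hlj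
  · rcases eq_or_ne l (i + 1) with rfl | h
    · rw [Function.update_self, Function.update_of_ne (by omega)]
      refine (hU j).trans ?_
      cases j with
      | zero => exact le_rfl
      | succ j => exact min_le_left _ _
    · rw [Function.update_of_ne h]
      rcases eq_or_ne l i with rfl | h'
      · rw [Function.update_self]
        exact (le_max_right _ _).trans (hL j)
      · rw [Function.update_of_ne (by omega)]
        exact hx.le_succ l j
  · rcases eq_or_ne l (i + 1) with rfl | h
    · rw [Function.update_self, Function.update_of_ne (by omega)]
      exact (le_max_left _ _).trans (hL j)
    · rw [Function.update_of_ne h]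
      rcases eq_or_ne l i with rfl | h'
      · rw [Function.update_self]
        exact (hU (j + 1)).trans (min_le_right _ _)
      · rw [Function.update_of_ne (by omega)]
        exact hx.succ_le l j
  · rw [Function.update_of_ne (by omega)]
    exact hx.top l hl

theorem togglePattern_togglePattern (hx : IsGelfandTsetlin k β x) (c i : ℕ) :
    _root_.togglePattern c i (_root_.togglePattern c i x) = x := by
  have : toggleRow c (x (i + 2)) (toggleRow c (x (i + 2)) (x (i + 1)) (x i)) (x i)
      = x (i + 1) := by
    ext j
    have h1 := hx.lower_le i j
    have h2 := hx.le_upper i j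
    simp only [toggleRow]
    split_ifs <;> omega
  unfold _root_.togglePattern
  rw [Function.update_self, Function.update_of_ne (by omega), Function.update_of_ne (by omega),
    this, Function.update_idem, Function.update_eq_self]

theorem boxesBeyond_togglePattern (hx : IsGelfandTsetlin k β x) {c c' : ℕ} (hc : c ≤ c')
    (i l : ℕ) :
    boxesBeyond k c' (_root_.togglePattern c i x l) = boxesBeyond k c' (x l) := by
  rcases eq_or_ne l (i + 1) with rfl | h
  · unfold _root_.togglePattern
    rw [Function.update_self]
    refine sum_congr rfl fun j _ => ?_
    have h1 := hx.lower_le i j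
    have h2 := hx.le_upper i j
    simp only [toggleRow]
    split_ifs <;> omega
  · unfold _root_.togglePattern
    rw [Function.update_of_ne h]

/-- The lower bound at `j` and the upper bound at `j + 1` are the max and min of the same two
entries, so the bounds sum to the two neighbouring rows. By `hc`, an entry beyond `c` has both its
bounds beyond `c`, so after capping it also counts as reflected. -/
theorem sum_min_toggleRow (hx : IsGelfandTsetlin k β x) {c i : ℕ} (hi : i + 1 < k)
    (hc : ∀ j < k, c < x (i + 1) j → c < x i j) :
    ∑ j ∈ range k, min (toggleRow c (x (i + 2)) (x (i + 1)) (x i) j) c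
        + ∑ j ∈ range k, min (x (i + 1) j) c
      = ∑ j ∈ range k, min (x (i + 2) j) c + ∑ j ∈ range k, min (x i j) c := by
  have hk0 : x (i + 2) k = 0 := hx.eq_zero _ _ (by omega)
  have key : ∀ j ∈ range k, min (toggleRow c (x (i + 2)) (x (i + 1)) (x i) j) c
      + min (x (i + 1) j) c = min (interlaceLower (x (i + 2)) (x i) j) c
        + min (interlaceUpper (x (i + 2)) (x i) j) c := by
    intro j hj
    have h1 := hx.lower_le i j
    have h2 := hx.le_upper i j
    have h3 := hc j (mem_range.1 hj)
    have h4 : x i j ≤ interlaceLower (x (i + 2)) (x i) j := le_max_right _ _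
    unfold toggleRow
    split_ifs <;> omega
  rw [← sum_add_distrib, sum_congr rfl key, sum_add_distrib]
  have e1 : ∑ j ∈ range k, min (interlaceUpper (x (i + 2)) (x i) j) c
      = min (x (i + 2) 0) c
        + ∑ j ∈ range k, min (min (x (i + 2) (j + 1)) (x i j)) c := by
    have hU : min (interlaceUpper (x (i + 2)) (x i) k) c = 0 := by
      obtain ⟨k, rfl⟩ : ∃ k', k = k' + 1 := ⟨k - 1, by omega⟩
      simp [interlaceUpper, hk0]
    have h := sum_range_succ (fun j => min (interlaceUpper (x (i + 2)) (x i) j) c) k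
    rw [hU, add_zero] at h
    exact h.symm.trans ((sum_range_succ' _ k).trans (add_comm _ _))
  have e2 : ∑ j ∈ range k, min (x (i + 2) j) c
      = min (x (i + 2) 0) c + ∑ j ∈ range k, min (x (i + 2) (j + 1)) c := by
    have h := sum_range_succ' (fun j => min (x (i + 2) j) c) k
    rw [sum_range_succ] at h
    simp only [hk0] at h
    omega
  have e3 : ∑ j ∈ range k, min (interlaceLower (x (i + 2)) (x i) j) c
        + ∑ j ∈ range k, min (min (x (i + 2) (j + 1)) (x i j)) c
      = ∑ j ∈ range k, min (x (i + 2) (j + 1)) c + ∑ j ∈ range k, min (x i j) c := by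
    rw [← sum_add_distrib, ← sum_add_distrib]
    refine sum_congr rfl fun j _ => ?_
    unfold interlaceLower
    omega
  omega

theorem boxesBeyond_zero_toggle (hx : IsGelfandTsetlin k β x) {c i : ℕ} (hi : i + 1 < k)
    (hc : ∀ j < k, c < x (i + 1) j → c < x i j) :
    boxesBeyond k 0 (_root_.togglePattern c i x (i + 1)) + boxesBeyond k 0 (x (i + 1))
        + boxesBeyond k c (x i) + boxesBeyond k c (x (i + 2))
      = boxesBeyond k 0 (x i) + boxesBeyond k 0 (x (i + 2)) + 2 * boxesBeyond k c (x (i + 1)) := by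
  have h := hx.sum_min_toggleRow hi hc
  have h1 := hx.boxesBeyond_togglePattern (le_refl c) i (i + 1)
  have e : _root_.togglePattern c i x (i + 1)
      = toggleRow c (x (i + 2)) (x (i + 1)) (x i) := Function.update_self ..
  rw [boxesBeyond_zero_eq k c, h1, boxesBeyond_zero_eq k c (x (i + 1)),
    boxesBeyond_zero_eq k c (x i), boxesBeyond_zero_eq k c (x (i + 2)), e]
  omega

theorem add_patternWeight_toggle (u : Fin k → ℤ) {c i : ℕ} (hi : i + 1 < k)
    (h : u ⟨i, by omega⟩ + boxesBeyond k 0 (_root_.togglePattern c i x (i + 1))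
        + boxesBeyond k 0 (x (i + 1))
      = u ⟨i + 1, hi⟩ + boxesBeyond k 0 (x i) + boxesBeyond k 0 (x (i + 2))) :
    u + patternWeight k (_root_.togglePattern c i x)
      = (u + patternWeight k x) ∘ Equiv.swap (⟨i, by omega⟩ : Fin k) ⟨i + 1, hi⟩ := by
  have hne : ∀ l, l ≠ i + 1 → _root_.togglePattern c i x l = x l := fun l hl =>
    Function.update_of_ne hl ..
  ext l
  rcases eq_or_ne l ⟨i, by omega⟩ with rfl | h1
  · simp only [Pi.add_apply, Function.comp_apply, Equiv.swap_apply_left, patternWeight]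
    rw [hne i (by omega)]
    linarith
  rcases eq_or_ne l ⟨i + 1, hi⟩ with rfl | h2
  · simp only [Pi.add_apply, Function.comp_apply, Equiv.swap_apply_right, patternWeight]
    rw [hne (i + 1 + 1) (by omega)]
    have : i + 1 + 1 = i + 2 := rfl
    rw [this]
    linarith
  · rw [Function.comp_apply, Equiv.swap_apply_of_ne_of_ne h1 h2]
    simp only [Pi.add_apply, patternWeight]
    rw [hne, hne]
    · exact fun h => h2 (Fin.ext h)
    · exact fun h => h1 (Fin.ext (by simpa using h))

end IsGelfandTsetlin

theorem finite_setOf_isGelfandTsetlin (k : ℕ) (β : ℕ → ℕ) :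
    {x | IsGelfandTsetlin k β x}.Finite := by
  let e : {x | IsGelfandTsetlin k β x} → (i : Fin k) → (j : Fin k) → Fin (β j + 1) :=
    fun x i j => ⟨x.1 i j, Nat.lt_succ_of_le (x.2.le_top i j)⟩
  have : Function.Injective e := by
    rintro ⟨x, hx⟩ ⟨y, hy⟩ h
    refine Subtype.ext (funext fun i => ?_)
    rcases lt_or_ge i k with hi | hi
    · ext j
      rcases lt_or_ge j i with hj | hj
      · have := congrFun (congrFun h ⟨i, hi⟩) ⟨j, hj.trans hi⟩
        exact congrArg Fin.val this
      · exact (hx.eq_zero i j hj).trans (hy.eq_zero i j hj).symm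
    · exact (hx.top i hi).trans (hy.top i hi).symm
  exact Set.finite_coe_iff.1 (Finite.of_injective e this)

/-- The finite set of Gelfand–Tsetlin patterns with top row `β`. -/
noncomputable def gelfandTsetlinPatterns (k : ℕ) (β : ℕ → ℕ) : Finset (ℕ → ℕ → ℕ) :=
  (finite_setOf_isGelfandTsetlin k β).toFinset

theorem mem_gelfandTsetlinPatterns {k : ℕ} {β : ℕ → ℕ} {x : ℕ → ℕ → ℕ} :
    x ∈ gelfandTsetlinPatterns k β ↔ IsGelfandTsetlin k β x := by
  simp [gelfandTsetlinPatterns]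

/-! ### Violations and the sign-reversing involution. -/

/-- Column `c` of the pattern `x` makes row `i + 1` overtake row `i`: adding to `u` the weight of
the part of `x` beyond column `c` breaks the strict decrease at `i`. -/
def IsViolation (k : ℕ) (u : Fin k → ℤ) (x : ℕ → ℕ → ℕ) (c i : ℕ) : Prop :=
  ∃ hi : i + 1 < k,
    u ⟨i, by omega⟩ + boxesBeyond k c (x (i + 1)) - boxesBeyond k c (x i)
      ≤ u ⟨i + 1, hi⟩ + boxesBeyond k c (x (i + 2)) - boxesBeyond k c (x (i + 1))

/-- A Littlewood–Richardson pattern relative to `u`: there is no violation. -/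
def IsLittlewoodRichardson (k : ℕ) (u : Fin k → ℤ) (x : ℕ → ℕ → ℕ) : Prop :=
  ∀ c i, ¬ IsViolation k u x c i

/-- The violation that is met first when the columns are read from right to left. -/
def IsFirstViolation (k : ℕ) (u : Fin k → ℤ) (x : ℕ → ℕ → ℕ) (c i : ℕ) : Prop :=
  IsViolation k u x c i ∧ (∀ c' i', c < c' → ¬ IsViolation k u x c' i') ∧
    ∀ i' < i, ¬ IsViolation k u x c i'

section

variable {k : ℕ} {u : Fin k → ℤ} {β : ℕ → ℕ} {x : ℕ → ℕ → ℕ}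

theorem IsFirstViolation.eq {c i c' i' : ℕ} (h : IsFirstViolation k u x c i)
    (h' : IsFirstViolation k u x c' i') : c = c' ∧ i = i' := by
  have hc : c = c' := le_antisymm (not_lt.1 fun hlt => h'.2.1 _ _ hlt h.1)
    (not_lt.1 fun hlt => h.2.1 _ _ hlt h'.1)
  subst hc
  exact ⟨rfl, le_antisymm (not_lt.1 fun hlt => h.2.2 _ hlt h'.1)
    (not_lt.1 fun hlt => h'.2.2 _ hlt h.1)⟩

namespace IsGelfandTsetlin

theorem not_isViolation_of_le (hx : IsGelfandTsetlin k β x) (hβ : Antitone β) (hu : StrictAnti u)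
    {c i : ℕ} (hc : β 0 ≤ c) : ¬ IsViolation k u x c i := by
  rintro ⟨hi, h⟩
  have h0 : ∀ l, boxesBeyond k c (x l) = 0 := fun l => sum_eq_zero fun j _ => by
    have h1 := hx.le_top l j
    have h2 := hβ (Nat.zero_le j)
    omega
  rw [h0, h0, h0] at h
  have : u ⟨i + 1, hi⟩ < u ⟨i, by omega⟩ := hu (Fin.mk_lt_mk.2 (Nat.lt_succ_self i))
  simp only [Nat.cast_zero, add_zero, sub_zero] at h
  omega

theorem exists_isFirstViolation (hx : IsGelfandTsetlin k β x) (hβ : Antitone β)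
    (hu : StrictAnti u) (h : ¬ IsLittlewoodRichardson k u x) :
    ∃ c i, IsFirstViolation k u x c i := by
  classical
  unfold IsLittlewoodRichardson at h
  push Not at h
  obtain ⟨c₀, hc₀⟩ := h
  have hb : ∀ c, (∃ i, IsViolation k u x c i) → c ≤ β 0 := fun c ⟨i, hi⟩ =>
    not_lt.1 fun hlt => hx.not_isViolation_of_le hβ hu hlt.le hi
  have hg := Nat.findGreatest_spec (P := fun c => ∃ i, IsViolation k u x c i) (hb _ hc₀) hc₀
  refine ⟨_, Nat.find hg, Nat.find_spec hg, fun c' i' hlt hv => ?_, fun i' hi' => Nat.find_min hg hi'⟩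
  exact Nat.findGreatest_is_greatest hlt (hb c' ⟨i', hv⟩) ⟨i', hv⟩

theorem isViolation_togglePattern_iff (hx : IsGelfandTsetlin k β x) {c c' : ℕ} (hc : c ≤ c')
    (i i' : ℕ) :
    IsViolation k u (_root_.togglePattern c i x) c' i' ↔ IsViolation k u x c' i' := by
  unfold IsViolation
  simp only [hx.boxesBeyond_togglePattern hc]

/-- The toggle changes nothing beyond column `c`, and only that part decides which violation comes
first. Hence toggling at the first violation is an involution. -/
theorem isFirstViolation_togglePattern (hx : IsGelfandTsetlin k β x) {c i : ℕ}
    (h : IsFirstViolation k u x c i) :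
    IsFirstViolation k u (_root_.togglePattern c i x) c i :=
  ⟨(hx.isViolation_togglePattern_iff le_rfl i i).2 h.1,
    fun c' i' hlt => mt (hx.isViolation_togglePattern_iff hlt.le i i').1 (h.2.1 c' i' hlt),
    fun i' hi' => mt (hx.isViolation_togglePattern_iff le_rfl i i').1 (h.2.2 i' hi')⟩

/-- One more column adds at least `0` at `i` and at most `1` at `i + 1`. Strict decrease beyond `c +
1` and its failure beyond `c` therefore force equality beyond `c`, so exchanging the counts in the
remaining columns exchanges the two total exponents. -/
theorem add_patternWeight_of_isFirstViolation (hx : IsGelfandTsetlin k β x) {c i : ℕ}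
    (h : IsFirstViolation k u x c i) :
    ∃ a b : Fin k, a ≠ b ∧ u + patternWeight k (_root_.togglePattern c i x)
      = (u + patternWeight k x) ∘ Equiv.swap a b := by
  obtain ⟨⟨hi, h1⟩, h2, -⟩ := h
  have h2 : ¬ _ ≤ _ := fun h => h2 (c + 1) i (Nat.lt_succ_self c) ⟨hi, h⟩
  refine ⟨⟨i, by omega⟩, ⟨i + 1, hi⟩, by simp, add_patternWeight_toggle u hi ?_⟩
  set n : ℕ → ℕ := fun l => ∑ j ∈ range k, if c < x l j then 1 else 0 with hn
  have hB : ∀ l, boxesBeyond k c (x l) = boxesBeyond k (c + 1) (x l) + n l :=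
    fun l => boxesBeyond_eq_succ_add k c (x l)
  have hle : ∀ j ∈ range k, (if c < x i j then 1 else 0) ≤ if c < x (i + 1) j then 1 else 0 := by
    intro j _
    have := hx.le_succ i j
    split_ifs <;> omega
  have hn1 : n i ≤ n (i + 1) := sum_le_sum hle
  have hn2 : n (i + 2) ≤ n (i + 1) + 1 := by
    have h3 := sum_range_succ' (fun j => if c < x (i + 2) j then 1 else 0) k
    rw [sum_range_succ] at h3
    have h4 : ∑ j ∈ range k, (if c < x (i + 2) (j + 1) then 1 else 0) ≤ n (i + 1) := by
      refine sum_le_sum fun j _ => ?_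
      have : x (i + 2) (j + 1) ≤ x (i + 1) j := hx.succ_le (i + 1) j
      split_ifs <;> omega
    have h5 : (if c < x (i + 2) 0 then 1 else 0) ≤ 1 := by split_ifs <;> omega
    simp only [hn] at h4 ⊢
    omega
  have b0 := hB i
  have b1 := hB (i + 1)
  have b2 := hB (i + 2)
  -- The forced equality puts no box of weight `i` in column `c + 1`, so the cut is compatible with
  -- the toggle.
  have hc : ∀ j < k, c < x (i + 1) j → c < x i j := by
    intro j hj hj1
    have h3 := (sum_eq_sum_iff_of_le hle).1 (show n i = n (i + 1) by omega) j (mem_range.2 hj)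
    rw [if_pos hj1] at h3
    by_contra h4
    rw [if_neg h4] at h3
    omega
  have h3 := hx.boxesBeyond_zero_toggle hi hc
  omega

theorem patternWeight_togglePattern_of_le (hx : IsGelfandTsetlin k β x) (hβ : Antitone β) {i : ℕ}
    (hi : i + 1 < k) :
    patternWeight k (_root_.togglePattern (β 0) i x)
      = patternWeight k x ∘ Equiv.swap (⟨i, by omega⟩ : Fin k) ⟨i + 1, hi⟩ := by
  have hle : ∀ l j, x l j ≤ β 0 := fun l j => (hx.le_top l j).trans (hβ (Nat.zero_le j))
  have h0 : ∀ l, boxesBeyond k (β 0) (x l) = 0 := fun l => sum_eq_zero fun j _ => by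
    have := hle l j
    omega
  have h3 := hx.boxesBeyond_zero_toggle (c := β 0) hi fun j _ h =>
    absurd h (hle (i + 1) j).not_gt
  rw [h0, h0, h0] at h3
  have h := add_patternWeight_toggle (0 : Fin k → ℤ) (x := x) (c := β 0) hi (by
    simp only [Pi.zero_apply]
    omega)
  simpa using h

theorem patternWeight_nonneg (hx : IsGelfandTsetlin k β x) (i : Fin k) :
    0 ≤ patternWeight k x i := by
  have : boxesBeyond k 0 (x i) ≤ boxesBeyond k 0 (x (i + 1)) :=
    sum_le_sum fun j _ => by simpa using hx.le_succ i j
  unfold patternWeight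
  omega

/-- Interlacing rows differ by a horizontal strip, which has at most one box in each column. -/
theorem patternWeight_le (hx : IsGelfandTsetlin k β x) (i : Fin k) :
    patternWeight k x i ≤ β 0 := by
  have h := sum_range_succ' (fun j => x (i + 1) j - 0) k
  rw [sum_range_succ] at h
  have h4 : ∑ j ∈ range k, (x (i + 1) (j + 1) - 0) ≤ boxesBeyond k 0 (x i) :=
    sum_le_sum fun j _ => by simpa using hx.succ_le i j
  have h5 := hx.le_top (i + 1) 0
  unfold patternWeight
  unfold boxesBeyond at h4 ⊢
  omega

end IsGelfandTsetlin

/-- This is the symmetry of Schur polynomials: adjacent transpositions generate the permutations,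
and whole-row toggles realise them. -/
theorem sum_patternWeight_comp_perm {E : Type*} [AddCommMonoid E] (hβ : Antitone β)
    (G : (Fin k → ℤ) → E) (σ : Equiv.Perm (Fin k)) :
    ∑ x ∈ gelfandTsetlinPatterns k β, G (patternWeight k x ∘ σ)
      = ∑ x ∈ gelfandTsetlinPatterns k β, G (patternWeight k x) := by
  cases k with
  | zero => exact sum_congr rfl fun x _ => congrArg G (Subsingleton.elim _ _)
  | succ n =>
    have hσ : σ ∈ Submonoid.closure
        (Set.range fun i : Fin n => Equiv.swap i.castSucc i.succ) := by
      rw [Equiv.Perm.mclosure_swap_castSucc_succ]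
      trivial
    induction hσ using Submonoid.closure_induction generalizing G with
    | mem σ hσ =>
      obtain ⟨i, rfl⟩ := hσ
      have hi : (i : ℕ) + 1 < n + 1 := by omega
      refine sum_nbij' (togglePattern (β 0) i) (togglePattern (β 0) i) ?_ ?_ ?_ ?_ ?_ <;>
        intro x hx <;> rw [mem_gelfandTsetlinPatterns] at hx
      · exact mem_gelfandTsetlinPatterns.2 (hx.togglePattern _ hi)
      · exact mem_gelfandTsetlinPatterns.2 (hx.togglePattern _ hi)
      · exact hx.togglePattern_togglePattern _ _
      · exact hx.togglePattern_togglePattern _ _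
      · rw [hx.patternWeight_togglePattern_of_le hβ hi]
        rfl
    | one => rfl
    | mul σ τ _ _ h1 h2 =>
      exact (h1 fun w => G (w ∘ τ)).trans (h2 G)

open Classical in
theorem sum_alternating_add_patternWeight (hβ : Antitone β) (hu : StrictAnti u)
    (F : (Fin k → ℤ) → ℂ) (hF : ∀ v i j, i ≠ j → F (v ∘ Equiv.swap i j) = -F v) :
    ∑ x ∈ gelfandTsetlinPatterns k β, F (u + patternWeight k x)
      = ∑ x ∈ gelfandTsetlinPatterns k β with IsLittlewoodRichardson k u x,
          F (u + patternWeight k x) := by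
  rw [← sum_filter_add_sum_filter_not _ (IsLittlewoodRichardson k u), add_eq_left]
  set S := {x ∈ gelfandTsetlinPatterns k β | ¬ IsLittlewoodRichardson k u x} with hS
  have hex : ∀ x ∈ S,
      ∃ p : ℕ × ℕ, IsFirstViolation k u x p.1 p.2 := by
    intro x hx
    rw [hS, mem_filter, mem_gelfandTsetlinPatterns] at hx
    obtain ⟨c, i, h⟩ := hx.1.exists_isFirstViolation hβ hu hx.2
    exact ⟨(c, i), h⟩
  choose! p hp using hex
  have hmem : ∀ x ∈ S,
      togglePattern (p x).1 (p x).2 x ∈ S := by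
    intro x hx
    have h := hp x hx
    rw [hS, mem_filter, mem_gelfandTsetlinPatterns] at hx ⊢
    exact ⟨hx.1.togglePattern _ h.1.1,
      fun hlr => hlr _ _ (hx.1.isFirstViolation_togglePattern h).1⟩
  have hneg : ∀ x ∈ S,
      F (u + patternWeight k (togglePattern (p x).1 (p x).2 x))
        = -F (u + patternWeight k x) := by
    intro x hx
    have h := hp x hx
    rw [hS, mem_filter, mem_gelfandTsetlinPatterns] at hx
    obtain ⟨a, b, hab, e⟩ := hx.1.add_patternWeight_of_isFirstViolation h
    rw [e, hF _ _ _ hab]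
  refine sum_involution (fun x _ => togglePattern (p x).1 (p x).2 x) ?_ ?_ hmem ?_
  · intro x hx
    rw [hneg x hx, add_neg_cancel]
  · intro x hx h0 he
    have := hneg x hx
    rw [he] at this
    exact h0 (self_eq_neg.1 this)
  · intro x hx
    have h1 := hp _ (hmem x hx)
    have h2 := hp x hx
    rw [hS, mem_filter, mem_gelfandTsetlinPatterns] at hx
    obtain ⟨e1, e2⟩ := (hx.1.isFirstViolation_togglePattern h2).eq h1
    rw [← e1, ← e2]
    exact hx.1.togglePattern_togglePattern _ _

/-! ### The highest pattern. -/

/-- The pattern of highest weight: all its rows are truncations of the top row. -/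
def highestPattern (β : ℕ → ℕ) (i j : ℕ) : ℕ := if j < i then β j else 0

theorem isGelfandTsetlin_highestPattern (hβ : Antitone β) (hβk : ∀ j, k ≤ j → β j = 0) :
    IsGelfandTsetlin k β (highestPattern β) := by
  refine ⟨fun i j h => if_neg h.not_gt, fun i j => ?_, fun i j => ?_, fun i hi => ?_⟩
  · unfold highestPattern
    split_ifs <;> omega
  · have := hβ (Nat.le_succ j)
    unfold highestPattern
    split_ifs <;> omega
  · ext j
    have := hβk j
    unfold highestPattern
    split_ifs <;> omega

theorem boxesBeyond_highestPattern_succ (c : ℕ) {i : ℕ} (hi : i < k) :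
    boxesBeyond k c (highestPattern β (i + 1))
      = boxesBeyond k c (highestPattern β i) + (β i - c) := by
  have : β i - c = ∑ j ∈ range k, if j = i then β i - c else 0 := by
    rw [sum_ite_eq' (range k) i, if_pos (mem_range.2 hi)]
  rw [this]
  unfold boxesBeyond
  rw [← sum_add_distrib]
  refine sum_congr rfl fun j _ => ?_
  unfold highestPattern
  rcases lt_trichotomy j i with h | rfl | h
  · rw [if_pos (by omega), if_pos h, if_neg h.ne, add_zero]
  · simp
  · rw [if_neg (by omega), if_neg (by omega), if_neg h.ne']
    omega

theorem patternWeight_highestPattern (i : Fin k) : patternWeight k (highestPattern β) i = β i := by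
  unfold patternWeight
  rw [boxesBeyond_highestPattern_succ 0 i.2]
  push_cast
  omega

theorem isLittlewoodRichardson_highestPattern (hβ : Antitone β) (hu : StrictAnti u) :
    IsLittlewoodRichardson k u (highestPattern β) := by
  rintro c i ⟨hi, h⟩
  have h1 := boxesBeyond_highestPattern_succ (β := β) c (show i < k by omega)
  have h2 := boxesBeyond_highestPattern_succ (β := β) c hi
  have h2 : boxesBeyond k c (highestPattern β (i + 2)) = _ := h2
  have h3 := hβ (Nat.le_succ i)
  have : u ⟨i + 1, hi⟩ < u ⟨i, by omega⟩ := hu (Fin.mk_lt_mk.2 (Nat.lt_succ_self i))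
  have h3 : β (i + 1) ≤ β i := h3
  omega

/-- The staircase `0, -1, -2, …`. -/
def staircase (k : ℕ) (i : Fin k) : ℤ := -(i : ℤ)

/-- Relative to the staircase, absence of violations means that the number of boxes beyond any `c`
is concave in the row index. At the first entry `c` of position `j`, this number does not grow from
row `j` to row `j + 1`, hence never exceeds its value at row `j` later; so `β j ≤ c`. -/
theorem IsGelfandTsetlin.eq_highestPattern (hx : IsGelfandTsetlin k β x)
    (h : IsLittlewoodRichardson k (staircase k) x) : x = highestPattern β := by
  have conc : ∀ c i, i + 1 < k → boxesBeyond k c (x (i + 2)) + boxesBeyond k c (x i)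
      ≤ 2 * boxesBeyond k c (x (i + 1)) := by
    intro c i hi
    have h1 : ¬ _ ≤ _ := fun h' => h c i ⟨hi, h'⟩
    simp only [staircase] at h1
    push_cast at h1
    omega
  have key : ∀ j, ∀ i, j < i → x i j = β j := by
    intro j
    induction j using Nat.strong_induction_on with
    | _ j ih =>
    intro i hji
    rcases le_or_gt k j with hk | hk
    · rw [hx.top i (by omega)]
    have hmono : Monotone fun i => x i j := monotone_nat_of_le_succ fun i => hx.le_succ i j
    refine le_antisymm (hx.le_top i j) (le_trans ?_ (hmono (Nat.succ_le_of_lt hji)))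
    set c := x (j + 1) j with hc
    have hrow : ∀ l, l < j → c ≤ β l := by
      have h1 : ∀ d l, l + d = j → x (j + 1) j ≤ x (l + 1) l := by
        intro d
        induction d with
        | zero => rintro l rfl; exact le_rfl
        | succ d ihd =>
          intro l hl
          refine (ihd (l + 1) (by omega)).trans ?_
          exact hx.succ_le (l + 1) l
      intro l hl
      exact (h1 (j - l) l (by omega)).trans (hx.le_top _ _)
    have hflat : boxesBeyond k c (x (j + 1)) = boxesBeyond k c (x j) := by
      refine sum_congr rfl fun l _ => ?_
      rcases lt_trichotomy l j with hl | rfl | hl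
      · rw [ih l hl (j + 1) (by omega), ih l hl j hl]
      · rw [← hc, hx.eq_zero l l le_rfl, Nat.sub_self, Nat.zero_sub]
      · rw [hx.eq_zero (j + 1) l (by omega), hx.eq_zero j l hl.le]
    have hdec : ∀ d, j + 1 + d ≤ k →
        boxesBeyond k c (x (j + 1 + d)) ≤ boxesBeyond k c (x (j + d)) ∧
        boxesBeyond k c (x (j + 1 + d)) ≤ boxesBeyond k c (x j) := by
      intro d
      induction d with
      | zero => intro _; exact ⟨hflat.le, hflat.le⟩
      | succ d ihd =>
        intro hd
        have h1 := ihd (by omega)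
        have h2 := conc c (j + d) (by omega)
        have e1 : j + 1 + (d + 1) = j + d + 2 := by ring
        have e2 : j + (d + 1) = j + d + 1 := by ring
        have e3 : j + 1 + d = j + d + 1 := by ring
        rw [e3] at h1
        rw [e1, e2]
        omega
    have hle := (hdec (k - (j + 1)) (by omega)).2
    rw [show j + 1 + (k - (j + 1)) = k by omega, hx.top k le_rfl] at hle
    have hterm : ∀ l ∈ range k, x j l - c ≤ β l - c := fun l _ =>
      Nat.sub_le_sub_right (hx.le_top j l) c
    have heq := (sum_eq_sum_iff_of_le hterm).1 (le_antisymm (sum_le_sum hterm) hle) j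
      (mem_range.2 hk)
    rw [hx.eq_zero j j le_rfl] at heq
    change β j ≤ c
    omega
  ext i j
  unfold highestPattern
  split_ifs with hij
  · exact key j i hij
  · exact hx.eq_zero i j (by omega)

/-! ### Determinants and the Littlewood–Richardson rule. -/

/-- The determinant of the matrix with entries `h (v i + u j)`. -/
noncomputable def hankelDet (h : ℤ → ℂ) (v u : Fin k → ℤ) : ℂ :=
  (Matrix.of fun i j => h (v i + u j)).det

theorem hankelDet_comm (h : ℤ → ℂ) (v u : Fin k → ℤ) : hankelDet h v u = hankelDet h u v := by
  unfold hankelDet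
  rw [← Matrix.det_transpose]
  congr 1
  ext i j
  simp [add_comm]

theorem hankelDet_comp_perm (h : ℤ → ℂ) (v u : Fin k → ℤ) (σ : Equiv.Perm (Fin k)) :
    hankelDet h v (u ∘ σ) = (Equiv.Perm.sign σ : ℤ) * hankelDet h v u :=
  Matrix.det_permute' σ (Matrix.of fun i j => h (v i + u j))

theorem hankelDet_comp_swap (h : ℤ → ℂ) (v u : Fin k → ℤ) {i j : Fin k} (hij : i ≠ j) :
    hankelDet h v (u ∘ Equiv.swap i j) = -hankelDet h v u := by
  rw [hankelDet_comp_perm, Equiv.Perm.sign_swap hij]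
  simp

/-- In each Leibniz term, moving the weight from `v` to `u` only permutes it, which the sum over
patterns does not see. -/
theorem sum_hankelDet_add_patternWeight (hβ : Antitone β) (h : ℤ → ℂ) (v u : Fin k → ℤ) :
    ∑ x ∈ gelfandTsetlinPatterns k β, hankelDet h (v + patternWeight k x) u
      = ∑ x ∈ gelfandTsetlinPatterns k β, hankelDet h v (u + patternWeight k x) := by
  unfold hankelDet
  simp only [Matrix.det_apply']
  rw [sum_comm, sum_comm (s := gelfandTsetlinPatterns k β)]
  refine sum_congr rfl fun σ _ => ?_
  rw [← mul_sum, ← mul_sum]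
  congr 1
  rw [← sum_patternWeight_comp_perm hβ
    (fun w => ∏ i, Matrix.of (fun i j => h (v i + (u + w) j)) (σ i) i) σ]
  refine sum_congr rfl fun x _ => prod_congr rfl fun i _ => ?_
  simp only [Matrix.of_apply, Pi.add_apply, Function.comp_apply]
  congr 1
  ring

theorem strictAnti_staircase (k : ℕ) : StrictAnti (staircase k) := fun i j h => by
  simp only [staircase]
  omega

theorem hankelDet_add_const_left (h : ℤ → ℂ) (v u : Fin k → ℤ) (s : ℤ) :
    hankelDet h (fun i => v i + s) u = hankelDet (fun z => h (z + s)) v u := by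
  unfold hankelDet
  congr 1
  ext i j
  simp only [Matrix.of_apply]
  congr 1
  ring

open Classical in
/-- The determinantal Littlewood–Richardson rule. -/
theorem hankelDet_staircase_add (hβ : Antitone β) (hβk : ∀ j, k ≤ j → β j = 0)
    (hu : StrictAnti u) (h : ℤ → ℂ) :
    hankelDet h (fun i => staircase k i + β i) u
      = ∑ x ∈ gelfandTsetlinPatterns k β with IsLittlewoodRichardson k u x,
          hankelDet h (staircase k) (u + patternWeight k x) := by
  -- The full sum is moved from `u` to the staircase, where only the highest pattern survives.
  rw [← sum_alternating_add_patternWeight hβ hu (hankelDet h (staircase k))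
      fun v i j hij => hankelDet_comp_swap h _ v hij,
    ← sum_hankelDet_add_patternWeight hβ,
    sum_alternating_add_patternWeight hβ (strictAnti_staircase k) (fun v => hankelDet h v u)
      fun v i j hij => by
        simp only [hankelDet_comm h _ u]
        exact hankelDet_comp_swap h _ v hij]
  have hs : ({x ∈ gelfandTsetlinPatterns k β | IsLittlewoodRichardson k (staircase k) x} :
      Finset (ℕ → ℕ → ℕ)) = {highestPattern β} := by
    ext x
    rw [mem_filter, mem_gelfandTsetlinPatterns, mem_singleton]
    constructor
    · exact fun hx => hx.1.eq_highestPattern hx.2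
    · rintro rfl
      exact ⟨isGelfandTsetlin_highestPattern hβ hβk,
        isLittlewoodRichardson_highestPattern hβ (strictAnti_staircase k)⟩
  rw [hs, sum_singleton]
  congr 1
  ext i
  rw [Pi.add_apply, patternWeight_highestPattern]

/-- At `c = 0` all boxes count. The surviving exponents are thus distinct and give genuine column
sets. -/
theorem IsLittlewoodRichardson.strictAnti_add (h : IsLittlewoodRichardson k u x) :
    StrictAnti (u + patternWeight k x) := by
  cases k with
  | zero => exact fun i => i.elim0
  | succ n =>
    rw [Fin.strictAnti_iff_succ_lt]
    intro i
    have h1 : ¬ _ ≤ _ := fun h' => h 0 i ⟨by omega, h'⟩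
    simp only [Pi.add_apply, patternWeight, Fin.val_succ, Fin.val_castSucc]
    have e1 : (⟨i, by omega⟩ : Fin (n + 1)) = i.castSucc := rfl
    have e2 : (⟨i + 1, by omega⟩ : Fin (n + 1)) = i.succ := rfl
    rw [e1, e2] at h1
    have e3 : (i : ℕ) + 1 + 1 = i + 2 := rfl
    rw [e3]
    omega

end

/-! ### Minors of Toeplitz matrices. -/

section

variable {k m n : ℕ}

/-- The bundled embedding of a strictly increasing integer vector with entries in `[0, n)`. -/
def finEmbeddingOfStrictMono (v : Fin k → ℤ) (hv : StrictMono v) (h0 : ∀ i, 0 ≤ v i)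
    (hn : ∀ i, v i < n) : Fin k ↪o Fin n :=
  OrderEmbedding.ofStrictMono
    (fun i => ⟨(v i).toNat, by have := h0 i; have := hn i; omega⟩) fun i j hij => by
      have h1 := hv hij
      have h2 := h0 i
      rw [Fin.mk_lt_mk]
      omega

theorem kMinor_toeplitzMatrix (g : ℤ → ℂ) (t : ℤ) (p : Fin k ↪o Fin m) (q : Fin k ↪o Fin n) :
    kMinor (toeplitzMatrix g t m n) p q
      = hankelDet (fun z => g (t - z)) (fun i => -((p i : ℕ) : ℤ)) fun j => ((q j : ℕ) : ℤ) := by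
  unfold kMinor hankelDet
  congr 1
  ext i j
  simp only [toeplitzMatrix, Matrix.submatrix_apply, Matrix.of_apply]
  congr 1
  ring

theorem sub_add_le_of_orderEmbedding (p : Fin k ↪o Fin m) {i j : Fin k} (hij : i ≤ j) :
    (j : ℕ) - i + p i ≤ (p j : ℕ) := by
  have h : ∀ d : ℕ, ∀ j : Fin k, (j : ℕ) = i + d → d + p i ≤ (p j : ℕ) := by
    intro d
    induction d with
    | zero =>
      intro j hj
      have : i = j := Fin.ext (by omega)
      rw [this]
      omega
    | succ d ih =>
      intro j hj
      have h1 := ih ⟨i + d, by omega⟩ rfl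
      have h2 : p ⟨i + d, by omega⟩ < p j := p.lt_iff_lt.2 (Fin.lt_def.2 (by simp; omega))
      have h2 := Fin.lt_def.1 h2
      omega
  exact h _ j (by have := Fin.le_def.1 hij; omega)

/-- Every minor of a Toeplitz matrix is a sum of a nonempty family of maximal minors of the
reshaped matrix. -/
theorem exists_kMinor_toeplitzMatrix_eq_sum (g : ℤ → ℂ) (t : ℤ) {M N : ℕ} (hM : k ≤ M)
    (hN : k ≤ N) (p : Fin k ↪o Fin M) (q : Fin k ↪o Fin N) :
    ∃ (s : Finset (ℕ → ℕ → ℕ)) (p' : Fin k ↪o Fin k)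
      (q' : (ℕ → ℕ → ℕ) → (Fin k ↪o Fin (M + N - k))), s.Nonempty ∧
      kMinor (toeplitzMatrix g t M N) p q
        = ∑ x ∈ s, kMinor (toeplitzMatrix g (t + M - k) k (M + N - k)) p' (q' x) := by
  classical
  have hpl : ∀ i : Fin k, (p i : ℕ) + k ≤ M + i ∧ (i : ℕ) ≤ p i := by
    intro i
    have hi := i.2
    have h1 := sub_add_le_of_orderEmbedding p
      (show i ≤ ⟨k - 1, by omega⟩ from Fin.le_def.2 (by simp; omega))
    have h2 := sub_add_le_of_orderEmbedding p
      (show (⟨0, by omega⟩ : Fin k) ≤ i from Fin.le_def.2 (by simp))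
    have h3 := (p ⟨k - 1, by omega⟩).2
    simp only at h1 h2
    omega
  -- Chosen so that `-p i = -i + γ i + (k - M)`.
  let γ : ℕ → ℕ := fun i => if h : i < k then M - k + i - p ⟨i, h⟩ else 0
  have hγ : Antitone γ := antitone_nat_of_succ_le fun i => by
    simp only [γ]
    split_ifs with h1 h2
    · have h3 := sub_add_le_of_orderEmbedding p
        (show (⟨i, h2⟩ : Fin k) ≤ ⟨i + 1, h1⟩ from Fin.le_def.2 (by simp))
      simp only at h3
      omega
    · omega
    · omega
    · exact le_rfl
  have hγk : ∀ j, k ≤ j → γ j = 0 := fun j hj => dif_neg hj.not_gt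
  have hγ0 : γ 0 ≤ M - k := by
    simp only [γ]
    split_ifs <;> omega
  -- Columns are reversed to decrease; the sign `ε` of the reversal occurs on both sides.
  let u : Fin k → ℤ := fun j => ((q (Fin.rev j) : ℕ) : ℤ)
  have hu : StrictAnti u := fun i j hij => by
    have h1 : q (Fin.rev j) < q (Fin.rev i) := q.lt_iff_lt.2 (Fin.rev_lt_rev.2 hij)
    have h1 := Fin.lt_def.1 h1
    simp only [u]
    omega
  let w : (ℕ → ℕ → ℕ) → Fin k → ℤ := fun x j => (u + patternWeight k x) (Fin.rev j)
  let s : Finset (ℕ → ℕ → ℕ) :=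
    {x ∈ gelfandTsetlinPatterns k γ | IsLittlewoodRichardson k u x}
  have hw : ∀ x ∈ s, StrictMono (w x) ∧ (∀ i, 0 ≤ w x i) ∧ ∀ i, w x i < (M + N - k : ℕ) := by
    intro x hx
    rw [mem_filter, mem_gelfandTsetlinPatterns] at hx
    refine ⟨fun i j hij => hx.2.strictAnti_add (Fin.rev_lt_rev.2 hij), fun i => ?_, fun i => ?_⟩
    · have h1 := hx.1.patternWeight_nonneg (Fin.rev i)
      simp only [w, u, Pi.add_apply]
      omega
    · have h1 := hx.1.patternWeight_le (Fin.rev i)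
      have h2 := (q (Fin.rev (Fin.rev i))).2
      simp only [w, u, Pi.add_apply]
      omega
  have hs : s.Nonempty := ⟨highestPattern γ, by
    rw [mem_filter, mem_gelfandTsetlinPatterns]
    exact ⟨isGelfandTsetlin_highestPattern hγ hγk, isLittlewoodRichardson_highestPattern hγ hu⟩⟩
  have hq : ∃ q' : (ℕ → ℕ → ℕ) → (Fin k ↪o Fin (M + N - k)),
      ∀ x ∈ s, ∀ i, ((q' x i : ℕ) : ℤ) = w x i := by
    have : ∀ x, ∃ q' : Fin k ↪o Fin (M + N - k), x ∈ s → ∀ i, ((q' i : ℕ) : ℤ) = w x i := by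
      intro x
      by_cases hx : x ∈ s
      · obtain ⟨h1, h2, h3⟩ := hw x hx
        exact ⟨finEmbeddingOfStrictMono (w x) h1 h2 h3, fun _ i => Int.toNat_of_nonneg (h2 i)⟩
      -- An arbitrary value outside `s`.
      · exact ⟨(Fin.castLEOrderEmb (by omega)), fun h => absurd h hx⟩
    choose q' hq' using this
    exact ⟨q', hq'⟩
  obtain ⟨q', hq'⟩ := hq
  refine ⟨s, RelEmbedding.refl _, q', hs, ?_⟩
  set ε : ℂ := ((Equiv.Perm.sign (Fin.revPerm : Equiv.Perm (Fin k)) : ℤ) : ℂ) with hε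
  have e1 : kMinor (toeplitzMatrix g t M N) p q
      = ε * hankelDet (fun z => g (t - (z + (k - M)))) (fun i => staircase k i + γ i) u := by
    rw [kMinor_toeplitzMatrix, ← hankelDet_add_const_left (fun z => g (t - z)),
      ← hankelDet_comp_perm]
    congr 1
    · ext i
      have h1 := hpl i
      have h2 : γ i = M - k + i - p i := dif_pos i.2
      rw [h2]
      simp only [staircase]
      omega
    · ext j
      simp [u]
  rw [e1, hankelDet_staircase_add hγ hγk hu, mul_sum]
  refine sum_congr rfl fun x hx => ?_
  rw [kMinor_toeplitzMatrix, ← hankelDet_comp_perm]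
  have e2 : (fun z : ℤ => g (t - (z + (k - M)))) = fun z => g (t + M - k - z) := by
    ext z
    congr 1
    ring
  rw [e2]
  congr 1
  ext j
  exact (hq' x hx j).symm

open scoped ComplexOrder

theorem IsSignConsistent.of_reshaped {g : ℤ → ℂ} {t : ℤ} {M N : ℕ} (hM : k ≤ M) (hN : k ≤ N)
    (h : IsSignConsistent k (toeplitzMatrix g (t + M - k) k (M + N - k))) :
    IsSignConsistent k (toeplitzMatrix g t M N) := by
  refine h.imp (fun h p q => ?_) fun h p q => ?_ <;>
    obtain ⟨s, p', q', -, e⟩ := exists_kMinor_toeplitzMatrix_eq_sum g t hM hN p q <;> rw [e]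
  · exact sum_nonneg fun x _ => h _ _
  · exact sum_nonpos fun x _ => h _ _

theorem IsStrictlySignConsistent.of_reshaped {g : ℤ → ℂ} {t : ℤ} {M N : ℕ} (hM : k ≤ M)
    (hN : k ≤ N) (h : IsStrictlySignConsistent k (toeplitzMatrix g (t + M - k) k (M + N - k))) :
    IsStrictlySignConsistent k (toeplitzMatrix g t M N) := by
  refine h.imp (fun h p q => ?_) fun h p q => ?_ <;>
    obtain ⟨s, p', q', hs, e⟩ := exists_kMinor_toeplitzMatrix_eq_sum g t hM hN p q <;> rw [e]
  · exact sum_pos (fun x _ => h _ _) hs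
  · exact sum_neg (fun x _ => h _ _) hs

/-- The reshaped matrix is the block of rows `N - k, …, N - 1` of the larger section. -/
theorem exists_kMinor_reshaped_eq (g : ℤ → ℂ) {N : ℕ} (hN : k ≤ N) (p : Fin k ↪o Fin k)
    (q : Fin k ↪o Fin (2 * N - k)) :
    ∃ p' : Fin k ↪o Fin (2 * N - k), kMinor (toeplitzMatrix g ((N : ℤ) - k) k (2 * N - k)) p q
      = kMinor (toeplitzMatrix g 0 (2 * N - k) (2 * N - k)) p' q := by
  refine ⟨OrderEmbedding.ofStrictMono (fun i => ⟨N - k + p i, by omega⟩) fun i j hij => ?_, ?_⟩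
  · have := Fin.lt_def.1 (p.lt_iff_lt.2 hij)
    rw [Fin.mk_lt_mk]
    omega
  · unfold kMinor
    congr 1
    ext i j
    change g ((N : ℤ) - k + (p i : ℕ) - (q j : ℕ))
      = g (0 + ((N - k + p i : ℕ) : ℤ) - (q j : ℕ))
    congr 1
    omega

end

theorem mainTheorem5 (g : ℤ → ℂ) (k : ℕ) (hk : 1 ≤ k) :
    (∀ (t : ℤ) (M N : ℕ), k ≤ min M N →
      (IsSignConsistent k (toeplitzMatrix g (t + (M : ℤ) - (k : ℤ)) k (M + N - k)) →
        IsSignConsistent k (toeplitzMatrix g t M N)) ∧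
      (IsStrictlySignConsistent k (toeplitzMatrix g (t + (M : ℤ) - (k : ℤ)) k (M + N - k)) →
        IsStrictlySignConsistent k (toeplitzMatrix g t M N))) ∧
    (IsSignConsistentOperator k (toeplitzOperator g) ↔
      ∀ N : ℕ, k ≤ N →
        IsSignConsistent k (toeplitzMatrix g ((N : ℤ) - (k : ℤ)) k (2 * N - k))) ∧
    (IsStrictlySignConsistentOperator k (toeplitzOperator g) ↔
      ∀ N : ℕ, k ≤ N →
        IsStrictlySignConsistent k (toeplitzMatrix g ((N : ℤ) - (k : ℤ)) k (2 * N - k))) := by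
  simp only [IsSignConsistentOperator, IsStrictlySignConsistentOperator,
    leadingSection_toeplitzOperator]
  have hshape : ∀ N : ℕ, toeplitzMatrix g ((N : ℤ) - k) k = toeplitzMatrix g (0 + N - k) k :=
    fun N => by rw [zero_add]
  refine ⟨fun t M N h => ?_, ⟨fun h N hN => ?_, fun h N hN => ?_⟩,
    ⟨fun h N hN => ?_, fun h N hN => ?_⟩⟩
  · have h := le_min_iff.1 h
    exact ⟨IsSignConsistent.of_reshaped h.1 h.2, IsStrictlySignConsistent.of_reshaped h.1 h.2⟩
  · refine (h (2 * N - k) (by omega)).imp (fun h p q => ?_) fun h p q => ?_ <;>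
      obtain ⟨p', e⟩ := exists_kMinor_reshaped_eq g hN p q <;> rw [e] <;> exact h _ _
  · have h1 := h N hN
    rw [two_mul, hshape] at h1
    exact h1.of_reshaped hN hN
  · refine (h (2 * N - k) (by omega)).imp (fun h p q => ?_) fun h p q => ?_ <;>
      obtain ⟨p', e⟩ := exists_kMinor_reshaped_eq g hN p q <;> rw [e] <;> exact h _ _
  · have h1 := h N hN
    rw [two_mul, hshape] at h1
    exact h1.of_reshaped hN hN
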